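/- Let $R$ be a commutative ring with unity. Call $R$ \emph{arithmetic} if, for every maximal ideal $P$ of $R$, the ideals of the localization $R_P$ are totally ordered by inclusion. A short exact sequence of $R$-modules $0\to N\to M\to L\to 0$ is \emph{pure-exact} if it remains exact after tensoring with any $R$-module, and \emph{RD-exact} if $rM\cap N=rN$ for every $r\in R$ (identifying $N$ with its image in $M$). An $R$-module $F$ is \emph{pure-injective} (respectively \emph{RD-injective}) if for every pure-exact (respectively RD-exact) sequence $0\to N\to M\to L\to 0$ of $R$-modules the sequence $0\to\operatorname{Hom}_R(L,F)\to\operatorname{Hom}_R(M,F)\to\operatorname{Hom}_R(N,F)\to 0$ is exact. Then the following assertions are equivalent: \begin{enumerate} \item $R$ is an arithmetic ring. \item Every RD-exact sequence of $R$-modules is pure-exact. \item Every pure-injective $R$-module is RD-injective. \end{enumerate} -/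

import Mathlib

open scoped Pointwise

universe u

/-- A module is uniserial if its submodules are totally ordered by inclusion. -/
def IsUniserialModule (R M : Type*) [CommRing R] [AddCommGroup M] [Module R M] : Prop :=
  ∀ A B : Submodule R M, A ≤ B ∨ B ≤ A

/-- A valuation ring (possibly with zero divisors): uniserial as a module over itself. -/
def IsUniserialRing (R : Type*) [CommRing R] : Prop :=
  IsUniserialModule R R

/-- `R` is arithmetic if its localization at every maximal ideal is a valuation ring. -/
def IsArithmeticRing (R : Type*) [CommRing R] : Prop :=
  ∀ (P : Ideal R) [P.IsMaximal], IsUniserialRing (Localization.AtPrime P)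

section Sequences

variable {R : Type*} [CommRing R] {N M L : Type*}
  [AddCommGroup N] [Module R N] [AddCommGroup M] [Module R M] [AddCommGroup L] [Module R L]

/-- The sequence `0 → N → M → L → 0` with maps `f` and `g` is exact. -/
structure IsShortExactSeq (f : N →ₗ[R] M) (g : M →ₗ[R] L) : Prop where
  injective : Function.Injective f
  exact : Function.Exact f g
  surjective : Function.Surjective g

/-- The short exact sequence `0 → N → M → L → 0` is RD-exact: `rM ∩ N = rN` for every `r`,
where `N` is identified with its image in `M`. -/
structure IsRDExact (f : N →ₗ[R] M) (g : M →ₗ[R] L) : Prop where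
  shortExact : IsShortExactSeq f g
  smul_inf : ∀ r : R, (r • (⊤ : Submodule R M)) ⊓ LinearMap.range f = r • LinearMap.range f

end Sequences

/-- The short exact sequence `0 → N → M → L → 0` is pure-exact: it remains exact after
tensoring with any `R`-module. -/
structure IsPureExact {R : Type u} [CommRing R] {N M L : Type u}
    [AddCommGroup N] [Module R N] [AddCommGroup M] [Module R M] [AddCommGroup L] [Module R L]
    (f : N →ₗ[R] M) (g : M →ₗ[R] L) : Prop where
  shortExact : IsShortExactSeq f g
  tensor : ∀ (X : Type u) [AddCommGroup X] [Module R X],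
    IsShortExactSeq (LinearMap.lTensor X f) (LinearMap.lTensor X g)

/-- `F` is pure-injective: `Hom(-, F)` keeps every pure-exact sequence exact. -/
def IsPureInjective (R : Type u) [CommRing R] (F : Type u) [AddCommGroup F] [Module R F] : Prop :=
  ∀ (N M L : Type u) [AddCommGroup N] [Module R N] [AddCommGroup M] [Module R M]
    [AddCommGroup L] [Module R L] (f : N →ₗ[R] M) (g : M →ₗ[R] L),
    IsPureExact f g → IsShortExactSeq (LinearMap.lcomp R F g) (LinearMap.lcomp R F f)

/-- `F` is RD-injective: `Hom(-, F)` keeps every RD-exact sequence exact. -/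
def IsRDInjective (R : Type u) [CommRing R] (F : Type u) [AddCommGroup F] [Module R F] : Prop :=
  ∀ (N M L : Type u) [AddCommGroup N] [Module R N] [AddCommGroup M] [Module R M]
    [AddCommGroup L] [Module R L] (f : N →ₗ[R] M) (g : M →ₗ[R] L),
    IsRDExact f g → IsShortExactSeq (LinearMap.lcomp R F g) (LinearMap.lcomp R F f)

/-! Arithmetic implies RD-exact = pure: a tensor vanishing in `X ⊗ M` encodes a finite linear system
over `N` solvable in `M`. At a maximal `P` some coefficient divides all others up to a factor
outside `P`, so elimination reduces to single divisibilities, which RD-exactness handles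
(`IsRDExact.exists_solution`). The annihilator of the tensor thus lies in no maximal ideal.

Conversely, if `a`, `b` are incomparable at `P`, resolve `R²/(a, b)R` by a sum of modules `R/rR`
(`CyclicCover.isRDExact`). Purity would lift the relation between the two generators, which
`mul_mem_of_not_dvd_mul` forbids modulo `P`.

Character modules are pure-injective and detect purity, which gives the third condition. -/

/-- The localization of `R` at `P` is a valuation ring iff any two elements of `R` are comparable
for divisibility up to a factor outside `P`. -/
theorem isUniserialRing_localization_iff {R : Type*} [CommRing R] (P : Ideal R) [P.IsPrime] :
    IsUniserialRing (Localization.AtPrime P) ↔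
      ∀ a b : R, ∃ s ∉ P, b ∣ s * a ∨ a ∣ s * b := by
  have key : ∀ a b : R, algebraMap R (Localization.AtPrime P) b ∣ algebraMap R _ a ↔
      ∃ s ∉ P, b ∣ s * a := by
    intro a b
    constructor
    · rintro ⟨z, hz⟩
      obtain ⟨⟨r, t⟩, rfl⟩ := IsLocalization.mk'_surjective P.primeCompl z
      have h : algebraMap R (Localization.AtPrime P) (t * a) = algebraMap R _ (b * r) := by
        rw [map_mul, hz, mul_left_comm, map_mul]
        congr 1
        exact IsLocalization.mk'_spec' _ r t
      obtain ⟨c, hc⟩ := (IsLocalization.eq_iff_exists P.primeCompl _).mp h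
      exact ⟨c * t, (c * t).2, c * r, by linear_combination hc⟩
    · rintro ⟨s, hs, r, hr⟩
      have hu : IsUnit (algebraMap R (Localization.AtPrime P) s) :=
        IsLocalization.map_units _ (⟨s, hs⟩ : P.primeCompl)
      rw [← hu.dvd_mul_left, ← map_mul, hr, map_mul]
      exact dvd_mul_right _ _
  constructor
  · intro h a b
    have aux : ∀ x y : Localization.AtPrime P, Ideal.span {x} ≤ Ideal.span {y} → y ∣ x :=
      fun x y => Ideal.span_singleton_le_span_singleton.mp
    rcases h (Ideal.span {algebraMap R _ a}) (Ideal.span {algebraMap R _ b}) with h | h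
    · obtain ⟨s, hs, h⟩ := (key a b).mp (aux _ _ h)
      exact ⟨s, hs, .inl h⟩
    · obtain ⟨s, hs, h⟩ := (key b a).mp (aux _ _ h)
      exact ⟨s, hs, .inr h⟩
  · intro h A B
    rw [or_iff_not_imp_left]
    intro hAB y hy
    obtain ⟨x, hxA, hxB⟩ := Set.not_subset.mp hAB
    obtain ⟨⟨a, s⟩, rfl⟩ := IsLocalization.mk'_surjective P.primeCompl x
    obtain ⟨⟨b, t⟩, rfl⟩ := IsLocalization.mk'_surjective P.primeCompl y
    have ha := IsLocalization.mk'_spec' (Localization.AtPrime P) a s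
    have hb := IsLocalization.mk'_spec' (Localization.AtPrime P) b t
    have hs := IsLocalization.map_units (Localization.AtPrime P) s
    have ht := IsLocalization.map_units (Localization.AtPrime P) t
    obtain ⟨u, hu, hab | hab⟩ := h a b
    · refine absurd ?_ hxB
      have hd := (key a b).mpr ⟨u, hu, hab⟩
      rw [← ha, ← hb, hs.dvd_mul_left, ht.mul_left_dvd] at hd
      exact Ideal.mem_of_dvd _ hd hy
    · have hd := (key b a).mpr ⟨u, hu, hab⟩
      rw [← ha, ← hb, ht.dvd_mul_left, hs.mul_left_dvd] at hd
      exact Ideal.mem_of_dvd _ hd hxA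

theorem IsArithmeticRing.exists_notMem_dvd {R : Type*} [CommRing R] (hR : IsArithmeticRing R)
    (P : Ideal R) [P.IsMaximal] (a b : R) : ∃ s ∉ P, b ∣ s * a ∨ a ∣ s * b :=
  (isUniserialRing_localization_iff P).mp (hR P) a b

/-- If elements of `R` are pairwise comparable for divisibility up to factors outside `P`, then a
nonempty finite family has a member dividing all of them up to a common factor outside `P`. -/
theorem exists_dvd_mul_of_comparable {R ι : Type*} [CommRing R] (P : Ideal R) [P.IsPrime]
    (hP : ∀ a b : R, ∃ s ∉ P, b ∣ s * a ∨ a ∣ s * b) (g : ι → R) {U : Finset ι}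
    (hU : U.Nonempty) : ∃ u ∈ U, ∃ s ∉ P, ∀ v ∈ U, g u ∣ s * g v := by
  induction hU using Finset.Nonempty.cons_induction with
  | singleton x => exact ⟨x, by simp, 1, P.one_notMem, by simp⟩
  | cons x U hx _ ih =>
    obtain ⟨u, huU, s, hs, hu⟩ := ih
    have mul_notMem : ∀ {t}, t ∉ P → t * s ∉ P := fun ht h =>
      (‹P.IsPrime›.mem_or_mem h).elim ht hs
    obtain ⟨t, ht, h | h⟩ := hP (g x) (g u)
    · refine ⟨u, by simp [huU], t * s, mul_notMem ht, fun v hv => ?_⟩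
      rcases Finset.mem_cons.mp hv with rfl | hv
      · rw [mul_right_comm]
        exact h.mul_right s
      · rw [mul_assoc]
        exact (hu v hv).mul_left t
    · refine ⟨x, by simp, t * s, mul_notMem ht, fun v hv => ?_⟩
      rcases Finset.mem_cons.mp hv with rfl | hv
      · exact dvd_mul_left _ _
      · rw [mul_assoc]
        exact h.trans (mul_dvd_mul_left t (hu v hv))

/-! ### Linear systems along RD-exact sequences -/

section Systems

variable {R : Type*} [CommRing R] {N M L : Type*}
  [AddCommGroup N] [Module R N] [AddCommGroup M] [Module R M] [AddCommGroup L] [Module R L]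

theorem IsRDExact.exists_smul_eq {f : N →ₗ[R] M} {g : M →ₗ[R] L} (h : IsRDExact f g)
    {r : R} {n : N} {m : M} (hm : r • m = f n) : ∃ n' : N, r • n' = n := by
  have hn : f n ∈ r • LinearMap.range f := by
    rw [← h.smul_inf]
    exact ⟨hm ▸ Submodule.smul_mem_pointwise_smul m r ⊤ trivial, LinearMap.mem_range_self f n⟩
  obtain ⟨_, ⟨n', rfl⟩, hn'⟩ := (Submodule.mem_smul_pointwise_iff_exists _ _ _).mp hn
  exact ⟨n', h.shortExact.injective (by rw [map_smul, hn'])⟩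

/-- A finite linear system with right-hand side in `N` that is solvable in `M` becomes solvable in
`N` after multiplication by some element outside `P`. -/
theorem IsRDExact.exists_solution {f : N →ₗ[R] M} {g : M →ₗ[R] L} (h : IsRDExact f g)
    (P : Ideal R) [P.IsPrime] (hP : ∀ a b : R, ∃ s ∉ P, b ∣ s * a ∨ a ∣ s * b)
    {ι κ : Type*} (T : Finset κ) (S : Finset ι) (a : ι → κ → R) (n : ι → N) (y : κ → M)
    (hy : ∀ i ∈ S, ∑ j ∈ T, a i j • y j = f (n i)) :
    ∃ s ∉ P, ∃ y' : κ → N, ∀ i ∈ S, ∑ j ∈ T, a i j • y' j = s • n i := by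
  classical
  induction hk : T.card generalizing T S a n with
  | zero =>
    obtain rfl := Finset.card_eq_zero.mp hk
    refine ⟨1, P.one_notMem, 0, fun i hi => ?_⟩
    have : n i = 0 := h.shortExact.injective (by rw [← hy i hi]; simp)
    simp [this]
  | succ k ih =>
    rcases S.eq_empty_or_nonempty with rfl | hS
    · exact ⟨1, P.one_notMem, 0, by simp⟩
    have hT : T.Nonempty := Finset.card_pos.mp (by omega)
    obtain ⟨⟨p, q⟩, hpq, s, hs, hdvd⟩ :=
      exists_dvd_mul_of_comparable P hP (fun x : ι × κ => a x.1 x.2) (hS.product hT)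
    obtain ⟨hp, hq⟩ : p ∈ S ∧ q ∈ T := Finset.mem_product.mp hpq
    have hdvd' : ∀ i j, ∃ c, i ∈ S → j ∈ T → s * a i j = a p q * c := by
      intro i j
      by_cases hij : i ∈ S ∧ j ∈ T
      · obtain ⟨c, hc⟩ := hdvd (i, j) (Finset.mem_product.mpr hij)
        exact ⟨c, fun _ _ => hc⟩
      · exact ⟨0, fun h1 h2 => absurd ⟨h1, h2⟩ hij⟩
    choose c hc using hdvd'
    obtain ⟨w, hw⟩ : ∃ w, a p q • w = s • n p := by
      refine h.exists_smul_eq (m := ∑ j ∈ T, c p j • y j) ?_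
      rw [map_smul, ← hy p hp, Finset.smul_sum, Finset.smul_sum]
      exact Finset.sum_congr rfl fun j hj => by rw [smul_smul, smul_smul, hc p j hp hj]
    -- Eliminate the unknown `q`: `s` times row `i` minus `c i q` times the pivot row has
    -- coefficient `s * a i q - c i q * a p q = 0` at `q`.
    obtain ⟨t, ht, z, hz⟩ := ih (T.erase q) S (fun i j => s * a i j - c i q * a p j)
      (fun i => s • n i - c i q • n p) (fun i hi => by
        have h1 := hy i hi
        have h2 := hy p hp
        rw [← Finset.add_sum_erase T _ hq] at h1 h2
        simp only [sub_smul, mul_smul, Finset.sum_sub_distrib, ← Finset.smul_sum, map_sub,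
          map_smul, ← h1, ← h2, smul_add]
        rw [smul_smul s, smul_smul (c i q) (a p q), hc i q hi hq, mul_comm (c i q)]
        abel) (by rw [Finset.card_erase_of_mem hq, hk]; rfl)
    have hst : s * s * t ∉ P := fun hm => (‹P.IsPrime›.mem_or_mem hm).elim
      (fun hm => (‹P.IsPrime›.mem_or_mem hm).elim hs hs) ht
    -- Back substitution: the pivot row, scaled by `s * t`, is solved for the unknown `q`.
    set v : N := t • w - ∑ j ∈ T.erase q, c p j • z j with hv
    have hpv : a p q • v = (s * t) • n p - s • ∑ j ∈ T.erase q, a p j • z j := by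
      rw [hv, smul_sub, smul_comm, hw, smul_smul, mul_comm t, Finset.smul_sum, Finset.smul_sum]
      congr 1
      exact Finset.sum_congr rfl fun j hj => by
        rw [smul_smul, smul_smul, hc p j hp (Finset.mem_of_mem_erase hj)]
    -- The extra factor `s` allows `s * a i q` to be replaced by `a p q * c i q` in every row.
    refine ⟨s * s * t, hst, fun j => if j = q then s • v else (s * s) • z j, fun i hi => ?_⟩
    have h3 : ∑ j ∈ T.erase q, a i j • (if j = q then s • v else (s * s) • z j) =
        (s * s) • ∑ j ∈ T.erase q, a i j • z j := by
      rw [Finset.smul_sum]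
      exact Finset.sum_congr rfl fun j hj => by
        rw [if_neg (Finset.ne_of_mem_erase hj), smul_comm]
    have h4 := hz i hi
    simp only [sub_smul, mul_smul, Finset.sum_sub_distrib, ← Finset.smul_sum] at h4
    rw [sub_eq_iff_eq_add] at h4
    rw [← Finset.add_sum_erase T _ hq, h3]
    beta_reduce
    rw [if_pos rfl, smul_smul, mul_comm (a i q), hc i q hi hq, mul_comm (a p q),
      mul_smul, hpv, mul_smul, mul_smul s s (∑ j ∈ T.erase q, a i j • z j), h4]
    module

end Systems

/-! ### Purity over arithmetic rings -/

section Tensor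

variable {R : Type u} [CommRing R] {N M L : Type u}
  [AddCommGroup N] [Module R N] [AddCommGroup M] [Module R M] [AddCommGroup L] [Module R L]

/-- A short exact sequence is pure-exact as soon as tensoring preserves injectivity. -/
theorem IsShortExactSeq.isPureExact {f : N →ₗ[R] M} {g : M →ₗ[R] L} (h : IsShortExactSeq f g)
    (hf : ∀ (X : Type u) [AddCommGroup X] [Module R X],
      Function.Injective (LinearMap.lTensor X f)) : IsPureExact f g where
  shortExact := h
  tensor X _ _ := ⟨hf X, lTensor_exact X h.exact h.surjective,
    LinearMap.lTensor_surjective X h.surjective⟩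

theorem TensorProduct.exists_sum_tmul_eq_of_span_eq_top {R ι X N : Type*} [CommRing R]
    [Fintype ι] [AddCommGroup X] [Module R X] [AddCommGroup N] [Module R N] {x : ι → X}
    (hx : Submodule.span R (Set.range x) = ⊤) (t : TensorProduct R X N) :
    ∃ n : ι → N, ∑ i, x i ⊗ₜ[R] n i = t := by
  induction t with
  | zero => exact ⟨0, by simp⟩
  | tmul y n =>
    obtain ⟨c, rfl⟩ := (Submodule.mem_span_range_iff_exists_fun R).mp
      (hx ▸ Submodule.mem_top : y ∈ Submodule.span R (Set.range x))
    exact ⟨fun i => c i • n, by simp [TensorProduct.sum_tmul, TensorProduct.smul_tmul]⟩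
  | add t₁ t₂ h₁ h₂ =>
    obtain ⟨n₁, rfl⟩ := h₁
    obtain ⟨n₂, rfl⟩ := h₂
    exact ⟨n₁ + n₂, by simp [TensorProduct.tmul_add, Finset.sum_add_distrib]⟩

/-- A tensor and the vanishing of its image each involve only finitely many elements of `X`. -/
theorem LinearMap.lTensor_injective_of_forall_fg {f : N →ₗ[R] M} {X : Type*} [AddCommGroup X]
    [Module R X] (h : ∀ Q : Submodule R X, Q.FG → Function.Injective (f.lTensor Q)) :
    Function.Injective (f.lTensor X) := by
  rw [injective_iff_map_eq_zero]
  intro t ht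
  obtain ⟨Q₀, hQ₀, hsub⟩ :=
    TensorProduct.exists_finite_submodule_left_of_setFinite {t} (Set.finite_singleton t)
  obtain ⟨t₀, rfl⟩ := hsub rfl
  rw [← LinearMap.comp_apply, LinearMap.lTensor_comp_rTensor, ← LinearMap.rTensor_comp_lTensor,
    LinearMap.comp_apply] at ht
  obtain ⟨Q, hle, hQ, h0⟩ :=
    TensorProduct.eq_zero_of_fg_of_subtype_eq_zero (Module.Finite.iff_fg.mp hQ₀) ht
  rw [← LinearMap.comp_apply, LinearMap.rTensor_comp_lTensor, ← LinearMap.lTensor_comp_rTensor,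
    LinearMap.comp_apply, map_eq_zero_iff _ (h Q hQ)] at h0
  rw [← Submodule.subtype_comp_inclusion Q₀ Q hle, LinearMap.rTensor_comp, LinearMap.comp_apply,
    h0, map_zero]

theorem IsArithmeticRing.lTensor_injective (hR : IsArithmeticRing R) {f : N →ₗ[R] M}
    {g : M →ₗ[R] L} (h : IsRDExact f g) (X : Type*) [AddCommGroup X] [Module R X] :
    Function.Injective (f.lTensor X) := by
  refine LinearMap.lTensor_injective_of_forall_fg fun Q hQ => ?_
  rw [injective_iff_map_eq_zero]
  intro t ht
  have := Module.Finite.iff_fg.mpr hQ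
  obtain ⟨k, x, hx⟩ := Module.Finite.exists_fin (R := R) (M := Q)
  obtain ⟨n, rfl⟩ := TensorProduct.exists_sum_tmul_eq_of_span_eq_top hx t
  simp only [map_sum, LinearMap.lTensor_tmul] at ht
  obtain ⟨l, a, y, hy, ha⟩ := TensorProduct.vanishesTrivially_of_sum_tmul_eq_zero R hx ht
  set τ := ∑ i, x i ⊗ₜ[R] n i with hτ
  -- This kernel is the annihilator of `τ`.
  suffices htop : LinearMap.ker (LinearMap.toSpanSingleton R _ τ) = ⊤ by
    have h1 : (1 : R) ∈ LinearMap.ker (LinearMap.toSpanSingleton R _ τ) := htop ▸ trivial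
    simpa using h1
  by_contra htop
  obtain ⟨P, hP, hle⟩ := Ideal.exists_le_maximal _ htop
  obtain ⟨s, hs, y', hy'⟩ := h.exists_solution P (hR.exists_notMem_dvd P) Finset.univ Finset.univ
    a n y fun i _ => (hy i).symm
  refine hs (hle ?_)
  have hvan : ∑ i, x i ⊗ₜ[R] (s • n i) = 0 :=
    TensorProduct.sum_tmul_eq_zero_of_vanishesTrivially R
      ⟨l, a, y', fun i => (hy' i (Finset.mem_univ i)).symm, ha⟩
  simpa [hτ, Finset.smul_sum] using hvan

theorem IsArithmeticRing.isPureExact (hR : IsArithmeticRing R) {f : N →ₗ[R] M}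
    {g : M →ₗ[R] L} (h : IsRDExact f g) : IsPureExact f g :=
  h.shortExact.isPureExact fun X _ _ => hR.lTensor_injective h X

end Tensor

/-! ### Character modules and purity -/

section Injectivity

variable {R : Type u} [CommRing R] {N M L : Type u}
  [AddCommGroup N] [Module R N] [AddCommGroup M] [Module R M] [AddCommGroup L] [Module R L]

/-- By adjunction, maps into the character module of `X` are characters of the tensor product with
`X`. -/
theorem lTensor_injective_iff_lcomp_characterModule_surjective {f : N →ₗ[R] M} {X : Type*}
    [AddCommGroup X] [Module R X] :
    Function.Injective (f.lTensor X) ↔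
      Function.Surjective (f.lcomp R (CharacterModule X)) := by
  rw [← rTensor_injective_iff_lcomp_surjective, LinearMap.lTensor_inj_iff_rTensor_inj]

theorem IsShortExactSeq.lcomp {f : N →ₗ[R] M} {g : M →ₗ[R] L} (h : IsShortExactSeq f g)
    {F : Type*} [AddCommGroup F] [Module R F] (hF : Function.Surjective (f.lcomp R F)) :
    IsShortExactSeq (g.lcomp R F) (f.lcomp R F) :=
  ⟨LinearMap.lcomp_injective_of_surjective g h.surjective,
    LinearMap.exact_lcomp_of_exact_of_surjective F h.exact h.surjective, hF⟩

theorem isPureInjective_characterModule (R X : Type u) [CommRing R] [AddCommGroup X]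
    [Module R X] : IsPureInjective R (CharacterModule X) := by
  intro N M L _ _ _ _ _ _ f g h
  exact h.shortExact.lcomp
    (lTensor_injective_iff_lcomp_characterModule_surjective.mp (h.tensor X).injective)

theorem isPureExact_of_characterModule {f : N →ₗ[R] M} {g : M →ₗ[R] L}
    (h : IsShortExactSeq f g) (hF : ∀ (X : Type u) [AddCommGroup X] [Module R X],
      Function.Surjective (f.lcomp R (CharacterModule X))) : IsPureExact f g :=
  h.isPureExact fun X _ _ => lTensor_injective_iff_lcomp_characterModule_surjective.mpr (hF X)

end Injectivity

/-! ### RD-exact resolution by modules `R/rR` -/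

section CyclicCover

variable (R : Type u) [CommRing R] (X : Type u) [AddCommGroup X] [Module R X]

/-- The direct sum of the modules `R ⧸ rR` over all pairs `(r, x)` with `r • x = 0`. -/
abbrev CyclicCover : Type u :=
  Π₀ i : {i : R × X // i.1 • i.2 = 0}, R ⧸ Submodule.span R {i.1.1}

open scoped Classical in
/-- The canonical map sending the generator with index `(r, x)` to `x`. -/
noncomputable def CyclicCover.proj : CyclicCover R X →ₗ[R] X :=
  DFinsupp.lsum ℕ fun i =>
    Submodule.liftQSpanSingleton i.1.1 (LinearMap.toSpanSingleton R X i.1.2) (by simpa using i.2)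

variable {R X}

open scoped Classical in
theorem CyclicCover.proj_single (i : {i : R × X // i.1 • i.2 = 0}) (u : R) :
    CyclicCover.proj R X (DFinsupp.single i (Submodule.Quotient.mk u)) = u • i.1.2 := by
  rw [CyclicCover.proj, DFinsupp.lsum_single, Submodule.liftQSpanSingleton_apply,
    LinearMap.toSpanSingleton_apply]

theorem CyclicCover.exists_proj_eq {r : R} {x : X} (h : r • x = 0) :
    ∃ y : CyclicCover R X, r • y = 0 ∧ CyclicCover.proj R X y = x := by
  classical
  refine ⟨DFinsupp.single ⟨(r, x), h⟩ (Submodule.Quotient.mk 1), ?_, ?_⟩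
  · rw [← DFinsupp.single_smul, ← Submodule.Quotient.mk_smul, smul_eq_mul, mul_one,
      (Submodule.Quotient.mk_eq_zero _).mpr (Submodule.mem_span_singleton_self r), DFinsupp.single_zero]
  · rw [CyclicCover.proj_single, one_smul]

/-- If `r • y` lies in the kernel, the image of `y` is killed by `r` and lifts to some `y₀` killed
by `r`; then `y - y₀` is in the kernel and `r • (y - y₀) = r • y`. -/
theorem CyclicCover.isRDExact :
    IsRDExact (N := LinearMap.ker (CyclicCover.proj R X)) (LinearMap.ker (CyclicCover.proj R X)).subtype (CyclicCover.proj R X) where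
  shortExact :=
    ⟨Submodule.injective_subtype _, LinearMap.exact_subtype_ker_map _, fun x =>
      let ⟨y, _, hy⟩ := CyclicCover.exists_proj_eq (zero_smul R x)
      ⟨y, hy⟩⟩
  smul_inf r := by
    rw [Submodule.range_subtype]
    apply le_antisymm
    · rintro _ ⟨hz, hk⟩
      obtain ⟨y, -, rfl⟩ := (Submodule.mem_smul_pointwise_iff_exists _ _ _).mp hz
      obtain ⟨y₀, h₀, hy₀⟩ := CyclicCover.exists_proj_eq (r := r) (x := CyclicCover.proj R X y)
        (by rw [← map_smul]; exact hk)
      refine (Submodule.mem_smul_pointwise_iff_exists _ _ _).mpr ⟨y - y₀, ?_, ?_⟩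
      · rw [LinearMap.mem_ker, map_sub, hy₀, sub_self]
      · rw [smul_sub, h₀, sub_zero]
    · intro z hz
      obtain ⟨y, hy, rfl⟩ := (Submodule.mem_smul_pointwise_iff_exists _ _ _).mp hz
      exact ⟨Submodule.smul_mem_pointwise_smul y r ⊤ trivial, Submodule.smul_mem _ r hy⟩

end CyclicCover

/-! ### From purity to comparability -/

section Converse

/-- Purity gives solvability of a single equation in two unknowns. -/
theorem IsPureExact.exists_add_smul_eq {R : Type u} [CommRing R] {N M L : Type u}
    [AddCommGroup N] [Module R N] [AddCommGroup M] [Module R M] [AddCommGroup L] [Module R L]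
    {f : N →ₗ[R] M} {g : M →ₗ[R] L} (h : IsPureExact f g) {a b : R} {n : N} {y z : M}
    (hn : a • y + b • z = f n) : ∃ y' z' : N, a • y' + b • z' = n := by
  -- Tensoring with `R/(a, b)` turns solvability into membership in `I • N`.
  set I : Ideal R := Ideal.span {a, b} with hI
  have mk_tmul : ∀ (c : R), c ∈ I → ∀ m : M, (1 : R ⧸ I) ⊗ₜ[R] (c • m) = 0 := fun c hc m => by
    rw [← TensorProduct.smul_tmul, Algebra.smul_def, mul_one, Ideal.Quotient.algebraMap_eq,
      Ideal.Quotient.eq_zero_iff_mem.mpr hc, TensorProduct.zero_tmul]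
  have h0 : (1 : R ⧸ I) ⊗ₜ[R] n = 0 := (h.tensor (R ⧸ I)).injective (by
    rw [LinearMap.lTensor_tmul, map_zero, ← hn, TensorProduct.tmul_add,
      mk_tmul a (Ideal.subset_span (by simp)), mk_tmul b (Ideal.subset_span (by simp)), add_zero])
  have hmem : n ∈ (I • ⊤ : Submodule R N) := by
    rw [← Submodule.Quotient.mk_eq_zero, ← TensorProduct.quotTensorEquivQuotSMul_mk_one_tmul, h0,
      map_zero]
  rw [hI, Ideal.span_insert, Submodule.sup_smul, Submodule.ideal_span_singleton_smul,
    Submodule.ideal_span_singleton_smul] at hmem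
  obtain ⟨_, h₁, _, h₂, rfl⟩ := Submodule.mem_sup.mp hmem
  obtain ⟨y', -, rfl⟩ := (Submodule.mem_smul_pointwise_iff_exists _ _ _).mp h₁
  obtain ⟨z', -, rfl⟩ := (Submodule.mem_smul_pointwise_iff_exists _ _ _).mp h₂
  exact ⟨y', z', rfl⟩

/-- Suppose `u * p ∉ P`. If `c ∈ P`, then `b` divides `(u * p - c * d) * a`; otherwise `a` divides
`c * p * b`. Either factor is outside `P`. -/
theorem mul_mem_of_not_dvd_mul {R : Type*} [CommRing R] {P : Ideal R} [P.IsPrime] {a b : R}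
    (hab : ∀ s ∉ P, ¬ a ∣ s * b) (hba : ∀ s ∉ P, ¬ b ∣ s * a) {r u v p q c d : R}
    (hp : r * p = c * a) (hq : r * q = c * b) (hd : a * u + b * v = r * d) : u * p ∈ P := by
  by_contra hup
  by_cases hc : c ∈ P
  · refine hba (u * p - c * d) (fun h => hup ?_) ⟨-(p * v), by linear_combination p * hd + d * hp⟩
    simpa using P.add_mem h (P.mul_mem_right d hc)
  · refine hab (c * p) (fun h => ?_) ⟨q * c, by linear_combination q * hp - p * hq⟩
    exact (‹P.IsPrime›.mem_or_mem h).elim hc fun h => hup (P.mul_mem_left u h)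

theorem isArithmeticRing_of_isPureExact (R : Type u) [CommRing R]
    (h : ∀ (N M L : Type u) [AddCommGroup N] [Module R N] [AddCommGroup M] [Module R M]
      [AddCommGroup L] [Module R L] (f : N →ₗ[R] M) (g : M →ₗ[R] L),
      IsRDExact f g → IsPureExact f g) : IsArithmeticRing R := by
  intro P _
  rw [isUniserialRing_localization_iff]
  by_contra! hcon
  obtain ⟨a, b, hcon⟩ := hcon
  have haP : a ∈ P := by
    by_contra ha
    exact (hcon a ha).2 (dvd_mul_right a b)
  let X := (R × R) ⧸ Submodule.span R {((a, b) : R × R)}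
  -- First coordinate modulo `P`, well defined as `a ∈ P`; it sends `e₁` to `1`.
  let φ : X →ₗ[R] R ⧸ P :=
    Submodule.liftQSpanSingleton _ (P.mkQ ∘ₗ LinearMap.fst R R R)
      (by simpa [Ideal.Quotient.eq_zero_iff_mem] using haP)
  let e₁ : X := Submodule.Quotient.mk (1, 0)
  let e₂ : X := Submodule.Quotient.mk (0, 1)
  have hrel : a • e₁ + b • e₂ = 0 := by
    refine (Submodule.Quotient.mk_eq_zero _).mpr ?_
    simp
  have hRD := CyclicCover.isRDExact (R := R) (X := X)
  obtain ⟨y, hy⟩ := hRD.shortExact.surjective e₁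
  obtain ⟨z, hz⟩ := hRD.shortExact.surjective e₂
  obtain ⟨y₀, z₀, h₀⟩ := (h _ _ _ _ _ hRD).exists_add_smul_eq (a := a) (b := b) (y := y) (z := z)
    (n := ⟨a • y + b • z, by simp [hy, hz, hrel]⟩) rfl
  have h₀' : a • (y - y₀) + b • (z - z₀) = 0 := by
    have := congrArg Subtype.val h₀
    simp only [Submodule.coe_add, Submodule.coe_smul] at this
    rw [smul_sub, smul_sub, sub_add_sub_comm, this, sub_self]
  have hker : ∀ w w' : CyclicCover R X, a • w + b • w' = 0 → φ (CyclicCover.proj R X w) = 0 := by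
    classical
    intro w w' hw
    rw [← DFinsupp.sum_single (f := w), DFinsupp.sum, map_sum, map_sum]
    refine Finset.sum_eq_zero fun i _ => ?_
    obtain ⟨u, hu⟩ := Submodule.Quotient.mk_surjective _ (w i)
    obtain ⟨v, hv⟩ := Submodule.Quotient.mk_surjective _ (w' i)
    obtain ⟨⟨⟨r, x⟩, hrx⟩, rfl⟩ : ∃ j, j = i := ⟨i, rfl⟩
    obtain ⟨⟨p, q⟩, rfl⟩ := Submodule.Quotient.mk_surjective _ x
    obtain ⟨c, hc⟩ := Submodule.mem_span_singleton.mp ((Submodule.Quotient.mk_eq_zero _).mp hrx)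
    have hi := DFunLike.congr_fun hw ⟨(r, Submodule.Quotient.mk (p, q)), hrx⟩
    rw [DFinsupp.add_apply, DFinsupp.smul_apply, DFinsupp.smul_apply, ← hu, ← hv] at hi
    obtain ⟨d, hd⟩ := Submodule.mem_span_singleton.mp ((Submodule.Quotient.mk_eq_zero _).mp hi)
    simp only [Prod.smul_mk, smul_eq_mul, Prod.mk.injEq] at hc hd
    rw [← hu, CyclicCover.proj_single]
    refine (Submodule.Quotient.mk_eq_zero _).mpr ?_
    exact mul_mem_of_not_dvd_mul (fun s hs => (hcon s hs).2) (fun s hs => (hcon s hs).1)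
      hc.1.symm hc.2.symm (hd.symm.trans (mul_comm _ _))
  have h1 := hker _ _ h₀'
  rw [map_sub, hy, y₀.2, sub_zero] at h1
  have h2 : (Submodule.Quotient.mk 1 : R ⧸ P) = 0 := h1
  exact P.one_notMem ((Submodule.Quotient.mk_eq_zero _).mp h2)

end Converse

theorem mainTheorem3 (R : Type u) [CommRing R] :
    List.TFAE [
      IsArithmeticRing R,
      ∀ (N M L : Type u) [AddCommGroup N] [Module R N] [AddCommGroup M] [Module R M]
        [AddCommGroup L] [Module R L] (f : N →ₗ[R] M) (g : M →ₗ[R] L),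
        IsRDExact f g → IsPureExact f g,
      ∀ (F : Type u) [AddCommGroup F] [Module R F],
        IsPureInjective R F → IsRDInjective R F] := by
  tfae_have 1 → 2 := fun hR _ _ _ _ _ _ _ _ _ _ _ h => hR.isPureExact h
  tfae_have 2 → 1 := isArithmeticRing_of_isPureExact R
  tfae_have 2 → 3 := fun h F _ _ hF N M L _ _ _ _ _ _ f g hfg =>
    hF N M L f g (h N M L f g hfg)
  tfae_have 3 → 2 := fun h N M L _ _ _ _ _ _ f g hfg =>
    isPureExact_of_characterModule hfg.shortExact fun X _ _ =>
      (h _ (isPureInjective_characterModule R X) N M L f g hfg).surjective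
  tfae_finish
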